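/- Let $f\in C(\mathbb{R};\mathbb{R})$ be locally Lipschitz continuous with $yf(y)>0$ for all $y\neq 0$ and $f(0)=0$. Put $F(y)=\int_y^1 \frac{du}{f(u)}$ for $y>0$, suppose that $F(y)\to+\infty$ as $y\to 0^+$, and let $F^{-1}$ denote the inverse of the strictly decreasing function $F$ on $(0,\infty)$. Let $g\in C([0,\infty);\mathbb{R})$ with $g(t)>0$ for all $t>0$, and let $\xi>0$. Suppose that $f$ is regularly varying at $0$ with index $\beta>1$, that is, $\lim_{y\to 0^+} f(\lambda y)/f(y)=\lambda^{\beta}$ for every $\lambda>0$, and that $g$ is regularly varying at infinity with index $-\theta$ for some $\theta\geq 0$, that is, $\lim_{t\to\infty} g(\lambda t)/g(t)=\lambda^{-\theta}$ for every $\lambda>0$. Suppose further that $$\lim_{t\to\infty}\frac{g(t)}{f(F^{-1}(t))}=+\infty .$$ Let $x$ be the unique continuous solution on $[0,\infty)$ of $$x'(t)=-f(x(t))+g(t),\quad t>0;\qquad x(0)=\xi,$$ and suppose that $x(t)\to 0$ as $t\to\infty$. (i) If $\theta>0$, then $$\lim_{t\to\infty}\frac{f(x(t))}{g(t)}=1 .$$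 (ii) If $\theta=0$ and $g$ is asymptotic to a decreasing function (that is, there is a function $\gamma$, non-increasing on $(0,\infty)$, with $g(t)/\gamma(t)\to 1$ as $t\to\infty$), then likewise $\lim_{t\to\infty} f(x(t))/g(t)=1$. -/

import Mathlib

open Set Filter Topology

namespace PerturbedODE

/-- `f ∈ RV₀(β)`: `f` is measurable and positive on `(0, ∞)`, and
`f (λ x) / f x → λ ^ β` as `x → 0⁺` for every `λ > 0`. -/
structure RegVaryZero (f : ℝ → ℝ) (β : ℝ) : Prop where
  measurable : Measurable (fun s : Ioi (0 : ℝ) => f s)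
  pos : ∀ x : ℝ, 0 < x → 0 < f x
  tendsto : ∀ l : ℝ, 0 < l → Tendsto (fun x => f (l * x) / f x) (𝓝[>] 0) (𝓝 (l ^ β))

/-- `h ∈ RV_∞(α)`: `h` is measurable and positive on `(0, ∞)`, and
`h (λ t) / h t → λ ^ α` as `t → ∞` for every `λ > 0`. -/
structure RegVaryInfty (h : ℝ → ℝ) (α : ℝ) : Prop where
  measurable : Measurable (fun s : Ioi (0 : ℝ) => h s)
  pos : ∀ t : ℝ, 0 < t → 0 < h t
  tendsto : ∀ l : ℝ, 0 < l → Tendsto (fun t => h (l * t) / h t) atTop (𝓝 (l ^ α))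

/-- `F(x) = ∫ₓ¹ du / f(u)`, used for `x > 0`. -/
noncomputable def bigF (f : ℝ → ℝ) (x : ℝ) : ℝ := ∫ u in x..1, 1 / f u

/-- The inverse of `F : (0, ∞) → ℝ`; it is meaningful on the range of `F` on `(0, ∞)`,
which contains `[0, ∞)` when `F(x) → ∞` as `x → 0⁺`. -/
noncomputable def bigFInv (f : ℝ → ℝ) : ℝ → ℝ := Function.invFunOn (bigF f) (Ioi 0)

/-- `x` is a continuous solution on `[0, ∞)` of
`x'(t) = -f(x(t)) + g(t)` for `t > 0`, `x(0) = ξ`. -/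
structure IsSolution (f g : ℝ → ℝ) (ξ : ℝ) (x : ℝ → ℝ) : Prop where
  continuousOn : ContinuousOn x (Ici 0)
  hasDerivAt : ∀ t : ℝ, 0 < t → HasDerivAt x (-f (x t) + g t) t
  initial : x 0 = ξ

/-- On `(0, ∞)`, `g` is asymptotic at infinity to a (not necessarily strictly)
decreasing function. -/
def AsymptoticToDecreasing (g : ℝ → ℝ) : Prop :=
  ∃ γ : ℝ → ℝ, AntitoneOn γ (Ioi 0) ∧ Tendsto (fun t => g t / γ t) atTop (𝓝 1)

end PerturbedODE

namespace PerturbedODE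

/-! On a window `[μt, t]` with `μ` near 1, regular variation makes `g` constant up to a factor `1 +
ε`, and `f` is almost increasing near 0. Along the solution, `F(x)' = 1 - g / f(x)`. If `f(x) >
(1+ε)g` on the whole window, then `F(x(t))` exceeds a multiple of `t`, so `x(t) ≤ C F⁻¹(t)` and
`f(x(t)) < g(t)`, a contradiction. If `g > (1+ε)f(x)` throughout, the second half window forces `x ≤
C F⁻¹(t)` at the midpoint, while `x'` is at least a multiple of `g(t)` on the first half, so `x`
there exceeds a multiple of `t g(t)`, which dominates `F⁻¹(t)`; again a contradiction. So each
one-sided comparison holds somewhere in the window. After its last such time `x` is monotone in the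
direction that carries the comparison to `t`, at the cost of `(1+ε)^3`. The step from `F(x) ≥ ct` to
`x ≤ C F⁻¹(t)` is `exists_le_mul_bigFInv`, where `β > 1` enters. -/

/-! ### Uniformity in regular variation. -/

/-- Baire category: the closed sets `A n` cover the line, so one contains a ball around some `a`.
Comparing the shifts `a + v` and `a` from the base point `s - a` gives uniformity in small `v`. -/
theorem exists_forall_abs_sub_le_of_tendsto_sub {h : ℝ → ℝ} (hc : Continuous h) {ρ : ℝ}
    (hlim : ∀ u, Tendsto (fun s => h (s + u) - h s) atTop (𝓝 (ρ * u))) {ε : ℝ} (hε : 0 < ε) :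
    ∃ δ > 0, ∀ᶠ s in atTop, ∀ v ∈ Icc 0 δ, |h (s + v) - h s| ≤ ε := by
  let A : ℕ → Set ℝ := fun n => {u | ∀ s, (n : ℝ) ≤ s → |h (s + u) - h s - ρ * u| ≤ ε / 4}
  have hA : ∀ n, IsClosed (A n) := by
    intro n
    simp only [A, ofPred_forall]
    refine isClosed_iInter fun s => isClosed_iInter fun _ => ?_
    exact isClosed_le (by fun_prop) continuous_const
  have hU : ⋃ n, A n = univ := by
    refine eq_univ_of_forall fun u => ?_
    have h1 := (hlim u).eventually (Metric.ball_mem_nhds _ (show 0 < ε / 4 by positivity))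
    obtain ⟨S, hS⟩ := eventually_atTop.1 h1
    obtain ⟨n, hn⟩ := exists_nat_ge S
    refine mem_iUnion.2 ⟨n, fun s hs => ?_⟩
    have := hS s (hn.trans hs)
    rw [Real.dist_eq] at this
    exact this.le
  obtain ⟨n, a, ha⟩ := nonempty_interior_of_iUnion_of_closed hA hU
  obtain ⟨r, hr, hball⟩ := Metric.isOpen_iff.1 isOpen_interior a ha
  have hsub : Metric.ball a r ⊆ A n := hball.trans interior_subset
  -- `r / 2` keeps `a + v` in the ball; the other bound gives `|ρ v| ≤ ε / 2`, added to two errors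
  -- `ε / 4`.
  refine ⟨min (r / 2) (ε / (2 * (|ρ| + 1))), by positivity, ?_⟩
  filter_upwards [eventually_ge_atTop (n + a)] with s hs v hv
  have hv1 : v ≤ r / 2 := hv.2.trans (min_le_left _ _)
  have hv2 : v ≤ ε / (2 * (|ρ| + 1)) := hv.2.trans (min_le_right _ _)
  have e1 := hsub (Metric.mem_ball_self hr) (s - a) (by linarith)
  have e2 := hsub (show a + v ∈ Metric.ball a r by
    rw [Real.ball_eq_Ioo, mem_Ioo]; constructor <;> linarith [hv.1]) (s - a) (by linarith)
  rw [show s - a + (a + v) = s + v by ring] at e2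
  rw [show s - a + a = s by ring] at e1
  have e3 : |ρ * v| ≤ ε / 2 := by
    rw [abs_mul, abs_of_nonneg hv.1]
    rw [le_div_iff₀ (by positivity)] at hv2
    nlinarith [hv.1, abs_nonneg ρ]
  rw [abs_le] at e1 e2 e3 ⊢
  constructor <;> nlinarith [e1.1, e1.2, e2.1, e2.2, e3.1, e3.2]

/-- Local part of the uniform convergence theorem for continuous regularly varying functions. -/
theorem exists_forall_le_mul_of_tendsto_div {k : ℝ → ℝ} (hc : ContinuousOn k (Ioi 0))
    (hpos : ∀ t, 0 < t → 0 < k t) {α : ℝ}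
    (hlim : ∀ l, 0 < l → Tendsto (fun t => k (l * t) / k t) atTop (𝓝 (l ^ α)))
    {ε : ℝ} (hε : 0 < ε) :
    ∃ μ, 0 < μ ∧ μ < 1 ∧ ∀ᶠ t in atTop, ∀ s ∈ Icc (μ * t) t,
      k s ≤ (1 + ε) * k t ∧ k t ≤ (1 + ε) * k s := by
  have hkpos : ∀ s, 0 < k (Real.exp s) := fun s => hpos _ (Real.exp_pos s)
  have hcont : Continuous fun s => Real.log (k (Real.exp s)) := by
    refine Continuous.log ?_ fun s => (hkpos s).ne'
    exact hc.comp_continuous Real.continuous_exp fun s => Real.exp_pos s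
  have hl : ∀ u, Tendsto (fun s => Real.log (k (Real.exp (s + u))) - Real.log (k (Real.exp s)))
      atTop (𝓝 (α * u)) := by
    intro u
    have h1 := ((hlim _ (Real.exp_pos u)).comp Real.tendsto_exp_atTop).log
      (Real.rpow_pos_of_pos (Real.exp_pos u) α).ne'
    rw [Real.log_rpow (Real.exp_pos u), Real.log_exp] at h1
    refine h1.congr fun s => ?_
    simp only [Function.comp_apply]
    rw [← Real.exp_add, add_comm u s, Real.log_div (hkpos _).ne' (hkpos _).ne']
  obtain ⟨δ, hδ, hev⟩ := exists_forall_abs_sub_le_of_tendsto_sub hcont hl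
    (Real.log_pos (show 1 < 1 + ε by linarith))
  refine ⟨Real.exp (-δ), Real.exp_pos _, by rw [← Real.exp_zero, Real.exp_lt_exp]; linarith, ?_⟩
  obtain ⟨S, hS⟩ := eventually_atTop.1 hev
  filter_upwards [eventually_ge_atTop (Real.exp (S + δ))] with t ht s hs
  have htpos : 0 < t := (Real.exp_pos _).trans_le ht
  have hspos : 0 < s := (mul_pos (Real.exp_pos _) htpos).trans_le hs.1
  have h1 : S + δ ≤ Real.log t := (Real.le_log_iff_exp_le htpos).2 ht
  have h2 : -δ + Real.log t ≤ Real.log s := by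
    have := Real.log_le_log (mul_pos (Real.exp_pos _) htpos) hs.1
    rwa [Real.log_mul (Real.exp_pos _).ne' htpos.ne', Real.log_exp] at this
  have h3 : Real.log s ≤ Real.log t := Real.log_le_log hspos hs.2
  have h4 := hS (Real.log s) (by linarith) (Real.log t - Real.log s)
    ⟨by linarith, by linarith⟩
  rw [add_sub_cancel, Real.exp_log htpos, Real.exp_log hspos, abs_le] at h4
  have hks := hpos s hspos
  have hkt := hpos t htpos
  have h1ε : (0 : ℝ) < 1 + ε := by linarith
  constructor
  · rw [← Real.log_le_log_iff hks (by positivity), Real.log_mul h1ε.ne' hkt.ne']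
    linarith [h4.1]
  · rw [← Real.log_le_log_iff hkt (by positivity), Real.log_mul h1ε.ne' hks.ne']
    linarith [h4.2]

/-- A function regularly varying at zero with positive index is almost increasing near zero. -/
theorem exists_forall_le_mul_of_le {f : ℝ → ℝ} (hc : Continuous f) {β : ℝ} (hβ : 0 < β)
    (hf : RegVaryZero f β) {ε : ℝ} (hε : 0 < ε) :
    ∃ r > 0, ∀ y z, 0 < y → y ≤ z → z < r → f y ≤ (1 + ε) * f z := by
  have hlim : ∀ l, 0 < l → Tendsto (fun t : ℝ => f (l * t)⁻¹ / f t⁻¹) atTop (𝓝 (l ^ (-β))) := by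
    intro l hl
    have h1 := (hf.tendsto l⁻¹ (inv_pos.2 hl)).comp tendsto_inv_atTop_nhdsGT_zero
    rw [Real.inv_rpow hl.le, ← Real.rpow_neg hl.le] at h1
    refine h1.congr fun t => ?_
    simp [mul_comm]
  -- Inversion moves the behaviour at zero to infinity. The resulting `μ` handles ratios in `[μ,
  -- 1]`; since `μ ^ β < 1`, iterating `z ↦ μ * z` handles the rest.
  obtain ⟨μ, hμ0, hμ1, hev⟩ := exists_forall_le_mul_of_tendsto_div (k := fun t => f t⁻¹)
    (hc.comp_continuousOn (continuousOn_inv₀.mono fun t (ht : 0 < t) => ht.ne'))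
    (fun t ht => hf.pos _ (inv_pos.2 ht)) hlim hε
  obtain ⟨S, hS⟩ := eventually_atTop.1 hev
  have h1 := (hf.tendsto μ hμ0).eventually
    (gt_mem_nhds (Real.rpow_lt_one hμ0.le hμ1 hβ))
  obtain ⟨r₁, hr₁, hr⟩ := mem_nhdsGT_iff_exists_Ioo_subset.1 h1
  have hr₁ : 0 < r₁ := hr₁
  have hstep : ∀ z, 0 < z → z < r₁ → f (μ * z) ≤ f z := by
    intro z hz hz'
    have : f (μ * z) / f z < 1 := hr ⟨hz, hz'⟩
    exact ((div_lt_one (hf.pos z hz)).1 this).le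
  have hpow : ∀ n : ℕ, ∀ z, 0 < z → z < r₁ → f (μ ^ n * z) ≤ f z := by
    intro n
    induction n with
    | zero => intro z _ _; simp
    | succ n ih =>
      intro z hz hz'
      have := ih (μ * z) (by positivity) (by nlinarith)
      rw [pow_succ, mul_assoc]
      exact this.trans (hstep z hz hz')
  refine ⟨min r₁ (max S 1)⁻¹, by positivity, fun y z hy hyz hz => ?_⟩
  have hz0 : 0 < z := hy.trans_le hyz
  obtain ⟨n, hn1, hn2⟩ := exists_nat_pow_near_of_lt_one (div_pos hy hz0)
    ((div_le_one hz0).2 hyz) hμ0 hμ1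
  set w := y / μ ^ n with hw
  have hμn : 0 < μ ^ n := by positivity
  have hw0 : 0 < w := by positivity
  have hyw : y = μ ^ n * w := by rw [hw]; field_simp
  have hwz : w ≤ z := by
    rw [hw, div_le_iff₀ hμn]
    rw [div_le_iff₀ hz0] at hn2
    linarith
  have hμz : μ * z ≤ w := by
    rw [hw, le_div_iff₀ hμn]
    rw [lt_div_iff₀ hz0, pow_succ] at hn1
    linarith
  have hzr : z < r₁ := hz.trans_le (min_le_left _ _)
  have hzS : z < (max S 1)⁻¹ := hz.trans_le (min_le_right _ _)
  have hwS : S ≤ w⁻¹ := by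
    refine (le_max_left S 1).trans ?_
    rw [le_inv_comm₀ (by positivity) hw0]
    linarith
  have h2 := (hS w⁻¹ hwS z⁻¹ ⟨?_, ?_⟩).2
  · simp only [inv_inv] at h2
    rw [hyw]
    exact (hpow n w hw0 (by linarith)).trans h2
  · rw [← div_eq_mul_inv, div_le_iff₀ hw0, ← div_eq_inv_mul, le_div_iff₀ hz0]
    exact hμz
  · exact inv_anti₀ hw0 hwz

/-! ### Mean value inequalities. -/

theorem sub_le_mul_sub_of_hasDerivAt {φ φ' : ℝ → ℝ} {a b C : ℝ} (hab : a ≤ b)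
    (h : ∀ s ∈ Icc a b, HasDerivAt φ (φ' s) s) (hC : ∀ s ∈ Ioo a b, φ' s ≤ C) :
    φ b - φ a ≤ C * (b - a) := by
  refine (convex_Icc a b).image_sub_le_mul_sub_of_deriv_le
    (fun s hs => (h s hs).continuousAt.continuousWithinAt) ?_ ?_ a (left_mem_Icc.2 hab) b
    (right_mem_Icc.2 hab) hab
  · exact fun s hs => (h s (interior_subset hs)).differentiableAt.differentiableWithinAt
  · intro s hs
    rw [(h s (interior_subset hs)).deriv]
    rw [interior_Icc] at hs
    exact hC s hs

theorem mul_sub_le_sub_of_hasDerivAt {φ φ' : ℝ → ℝ} {a b C : ℝ} (hab : a ≤ b)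
    (h : ∀ s ∈ Icc a b, HasDerivAt φ (φ' s) s) (hC : ∀ s ∈ Ioo a b, C ≤ φ' s) :
    C * (b - a) ≤ φ b - φ a := by
  have := sub_le_mul_sub_of_hasDerivAt (φ := fun s => -φ s) (φ' := fun s => -φ' s) (C := -C) hab
    (fun s hs => (h s hs).neg) (fun s hs => neg_le_neg (hC s hs))
  linarith

/-! ### The function `F` and its inverse. -/

section bigF

variable {f : ℝ → ℝ}

theorem hasDerivAt_bigF (hc : Continuous f) (hpos : ∀ y, 0 < y → 0 < f y) {y : ℝ} (hy : 0 < y) :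
    HasDerivAt (bigF f) (-(1 / f y)) y := by
  have hcont : ContinuousOn (fun u => 1 / f u) (Ioi 0) :=
    continuousOn_const.div hc.continuousOn fun u hu => (hpos u hu).ne'
  refine intervalIntegral.integral_hasDerivAt_left ?_ ?_ ?_
  · refine (hcont.mono fun u hu => ?_).intervalIntegrable
    exact (lt_min hy one_pos).trans_le hu.1
  · exact hcont.stronglyMeasurableAtFilter isOpen_Ioi y hy
  · exact hcont.continuousAt (Ioi_mem_nhds hy)

theorem bigF_antitoneOn (hc : Continuous f) (hpos : ∀ y, 0 < y → 0 < f y) :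
    AntitoneOn (bigF f) (Ioi 0) := by
  intro a ha b _ hab
  have ha : 0 < a := ha
  have := sub_le_mul_sub_of_hasDerivAt (C := 0) hab
    (fun s hs => hasDerivAt_bigF hc hpos (ha.trans_le hs.1))
    (fun s hs => by
      have := hpos s (ha.trans hs.1)
      rw [neg_nonpos]; positivity)
  linarith

theorem bigF_nonneg (hc : Continuous f) (hpos : ∀ y, 0 < y → 0 < f y) {y : ℝ} (hy : 0 < y)
    (hy1 : y ≤ 1) : 0 ≤ bigF f y := by
  have := bigF_antitoneOn hc hpos hy (show (1 : ℝ) ∈ Ioi 0 from mem_Ioi.2 one_pos) hy1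
  rwa [bigF, intervalIntegral.integral_same] at this

theorem bigFInv_spec (hc : Continuous f) (hpos : ∀ y, 0 < y → 0 < f y)
    (hF : Tendsto (bigF f) (𝓝[>] 0) atTop) {t : ℝ} (ht : 0 ≤ t) :
    0 < bigFInv f t ∧ bigF f (bigFInv f t) = t := by
  refine Function.invFunOn_pos ?_
  obtain ⟨y, hyt, hy0, hy1⟩ := ((hF.eventually_ge_atTop t).and
    (Ioo_mem_nhdsGT (one_pos : (0 : ℝ) < 1))).exists
  have hcont : ContinuousOn (bigF f) (Icc y 1) := fun u hu =>
    (hasDerivAt_bigF hc hpos (hy0.trans_le hu.1)).continuousAt.continuousWithinAt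
  obtain ⟨u, hu, hut⟩ := intermediate_value_Icc' hy1.le hcont
    (show t ∈ Icc (bigF f 1) (bigF f y) from ⟨by simpa [bigF] using ht, hyt⟩)
  exact ⟨u, hy0.trans_le hu.1, hut⟩

theorem tendsto_bigFInv (hc : Continuous f) (hpos : ∀ y, 0 < y → 0 < f y)
    (hF : Tendsto (bigF f) (𝓝[>] 0) atTop) : Tendsto (bigFInv f) atTop (𝓝[>] 0) := by
  refine tendsto_nhdsWithin_iff.2 ⟨?_, ?_⟩
  · refine tendsto_order.2 ⟨fun a ha => ?_, fun a ha => ?_⟩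
    · filter_upwards [eventually_ge_atTop 0] with t ht
      exact ha.trans (bigFInv_spec hc hpos hF ht).1
    · filter_upwards [eventually_ge_atTop 0, eventually_gt_atTop (bigF f a)] with t ht hta
      obtain ⟨h1, h2⟩ := bigFInv_spec hc hpos hF ht
      by_contra! h
      have := bigF_antitoneOn hc hpos ha h1 h
      linarith
  · filter_upwards [eventually_ge_atTop 0] with t ht
    exact (bigFInv_spec hc hpos hF ht).1

/-- Integrate `1 / f` over `[z, 2z]` only: there `f ≤ 2 f(2z)`, and `f(2z) ≤ (2^β + 1) f(z)`. -/
theorem exists_mul_le_bigF_mul (hc : Continuous f) {β : ℝ} (hβ : 0 < β)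
    (hf : RegVaryZero f β) : ∃ c > 0, ∀ᶠ z in 𝓝[>] 0, c * z ≤ bigF f z * f z := by
  obtain ⟨r, hr, hmono⟩ := exists_forall_le_mul_of_le hc hβ hf one_pos
  have h2 : (0 : ℝ) < 2 ^ β := by positivity
  have hlim := (hf.tendsto 2 two_pos).eventually (gt_mem_nhds (lt_add_one _))
  refine ⟨1 / (2 * (2 ^ β + 1)), by positivity, ?_⟩
  filter_upwards [hlim, Ioo_mem_nhdsGT (show 0 < min (r / 2) (1 / 2) by positivity)] with z hz hzr
  have hz0 : 0 < z := hzr.1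
  have hzr1 : z < r / 2 := hzr.2.trans_le (min_le_left _ _)
  have hzr2 : z < 1 / 2 := hzr.2.trans_le (min_le_right _ _)
  have hf2 := hf.pos (2 * z) (by positivity)
  have hf1 := hf.pos z hz0
  rw [div_lt_iff₀ hf1] at hz
  have h1 := sub_le_mul_sub_of_hasDerivAt (C := -(1 / (2 * f (2 * z))))
    (show z ≤ 2 * z by linarith)
    (fun s hs => hasDerivAt_bigF hc hf.pos (hz0.trans_le hs.1)) (fun s hs => by
      refine neg_le_neg (one_div_le_one_div_of_le (hf.pos s (hz0.trans hs.1)) ?_)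
      have := hmono s (2 * z) (hz0.trans hs.1) hs.2.le (by linarith)
      linarith)
  have h3 := bigF_nonneg hc hf.pos (show 0 < 2 * z by positivity) (by linarith)
  have h4 : z / (2 * f (2 * z)) ≤ bigF f z := by
    have : -(1 / (2 * f (2 * z))) * (2 * z - z) = -(z / (2 * f (2 * z))) := by ring
    linarith
  rw [div_le_iff₀ (by positivity)] at h4
  have h5 : 0 ≤ bigF f z := bigF_nonneg hc hf.pos hz0 (by linarith)
  rw [one_div_mul_eq_div, div_le_iff₀ (by positivity)]
  nlinarith [mul_le_mul_of_nonneg_left hz.le h5]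

/-- For `2 < m < 2^β`, eventually `f(2z) > m f(z)`, so `F(2z) - (2/m) F(z)` is nondecreasing near 0,
hence bounded above there. -/
theorem exists_bigF_two_mul_le (hc : Continuous f) {β : ℝ} (hβ : 1 < β) (hf : RegVaryZero f β)
    (hF : Tendsto (bigF f) (𝓝[>] 0) atTop) :
    ∃ q, 0 < q ∧ q < 1 ∧ ∀ᶠ z in 𝓝[>] 0, bigF f (2 * z) ≤ q * bigF f z := by
  have h2β : (2 : ℝ) < 2 ^ β := by
    simpa using Real.rpow_lt_rpow_of_exponent_lt one_lt_two hβ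
  obtain ⟨m, hm2, hmβ⟩ := exists_between h2β
  obtain ⟨r, hr, hlim⟩ := mem_nhdsGT_iff_exists_Ioo_subset.1
    ((hf.tendsto 2 two_pos).eventually (lt_mem_nhds hmβ))
  have hr : 0 < r := hr
  have hm : 0 < m := by linarith
  have hp1 : 2 / m < 1 := (div_lt_one hm).2 hm2
  set w := r / 2 with hw
  have hw0 : 0 < w := by positivity
  have key : ∀ z, 0 < z → z < w →
      bigF f (2 * z) - 2 / m * bigF f z ≤ bigF f (2 * w) - 2 / m * bigF f w := by
    intro z hz hzw
    have := mul_sub_le_sub_of_hasDerivAt (φ := fun z => bigF f (2 * z) - 2 / m * bigF f z)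
      (φ' := fun z => -(1 / f (2 * z)) * 2 - 2 / m * -(1 / f z)) (C := 0) hzw.le
      (fun s hs => by
        have hs0 : 0 < s := hz.trans_le hs.1
        have h1 : HasDerivAt (fun z : ℝ => 2 * z) 2 s := by
          simpa using (hasDerivAt_id s).const_mul 2
        exact ((hasDerivAt_bigF hc hf.pos (show 0 < 2 * s by positivity)).comp s h1).sub
          ((hasDerivAt_bigF hc hf.pos hs0).const_mul _))
      (fun s hs => by
        have hs0 : 0 < s := hz.trans hs.1
        have hfs := hf.pos s hs0
        have hfs2 := hf.pos (2 * s) (by positivity)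
        have h1 : m < f (2 * s) / f s := hlim ⟨hs0, by linarith [hs.2]⟩
        rw [lt_div_iff₀ hfs] at h1
        have h2 : 1 / f (2 * s) ≤ 1 / (m * f s) := one_div_le_one_div_of_le (by positivity) h1.le
        have h3 : 1 / (m * f s) = 1 / m * (1 / f s) := by field_simp
        have h4 : 2 / m * (1 / f s) = 2 * (1 / m * (1 / f s)) := by ring
        linarith)
    linarith
  -- Midway between `2 / m` and 1: the spare `(1 - 2 / m) / 2` times `F(z) → ∞` absorbs the
  -- constant.
  refine ⟨(1 + 2 / m) / 2, by positivity, by linarith, ?_⟩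
  filter_upwards [Ioo_mem_nhdsGT hw0, hF.eventually_ge_atTop
    ((bigF f (2 * w) - 2 / m * bigF f w) / ((1 - 2 / m) / 2))] with z hz hzF
  rw [div_le_iff₀ (by linarith)] at hzF
  have := key z hz.1 hz.2
  linarith

/-- Each doubling of the argument shrinks `F` by `q`, so `n` doublings with `q ^ n < c` bring `F`
from `t` below `c * t`; `C = 2 ^ n` works because `F` is decreasing. -/
theorem exists_le_mul_bigFInv (hc : Continuous f) {β : ℝ} (hβ : 1 < β) (hf : RegVaryZero f β)
    (hF : Tendsto (bigF f) (𝓝[>] 0) atTop) {c : ℝ} (hcpos : 0 < c) :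
    ∃ C > 0, ∀ᶠ t in atTop, ∀ y, c * t ≤ bigF f y → y ≤ C * bigFInv f t := by
  obtain ⟨q, hq0, hq1, hq⟩ := exists_bigF_two_mul_le hc hβ hf hF
  have hz := tendsto_bigFInv hc hf.pos hF
  have hiter : ∀ n : ℕ, ∀ᶠ z in 𝓝[>] 0, bigF f (2 ^ n * z) ≤ q ^ n * bigF f z := by
    intro n
    induction n with
    | zero => simp
    | succ n ih =>
      have h1 : Tendsto (fun z : ℝ => 2 * z) (𝓝[>] 0) (𝓝[>] 0) := by
        refine tendsto_nhdsWithin_iff.2 ⟨?_, ?_⟩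
        · have : Tendsto (fun z : ℝ => 2 * z) (𝓝 0) (𝓝 (2 * 0)) := tendsto_id.const_mul 2
          rw [mul_zero] at this
          exact this.mono_left nhdsWithin_le_nhds
        · filter_upwards [self_mem_nhdsWithin] with z hz
          exact mul_pos two_pos (mem_Ioi.1 hz)
      filter_upwards [hq, h1.eventually ih] with z h2 h3
      rw [pow_succ, pow_succ, mul_assoc, mul_assoc]
      exact h3.trans (mul_le_mul_of_nonneg_left h2 (by positivity))
  obtain ⟨n, hn⟩ := exists_pow_lt_of_lt_one hcpos hq1
  refine ⟨2 ^ n, by positivity, ?_⟩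
  filter_upwards [hz.eventually (hiter n), eventually_gt_atTop 0] with t h1 ht y hy
  obtain ⟨h2, h3⟩ := bigFInv_spec hc hf.pos hF ht.le
  rw [h3] at h1
  by_contra! h
  have h4 : 0 < 2 ^ n * bigFInv f t := by positivity
  have := bigF_antitoneOn hc hf.pos h4 (h4.trans h) h.le
  nlinarith

end bigF

theorem exists_last_nonpos {φ : ℝ → ℝ} {a t : ℝ} (hφ : ContinuousOn φ (Icc a t))
    (h : ∃ s ∈ Icc a t, φ s ≤ 0) :
    ∃ s ∈ Icc a t, φ s ≤ 0 ∧ ∀ u ∈ Ioc s t, 0 < φ u := by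
  have hclosed : IsClosed (Icc a t ∩ φ ⁻¹' Iic 0) := hφ.preimage_isClosed_of_isClosed isClosed_Icc
    isClosed_Iic
  have hcomp : IsCompact (Icc a t ∩ φ ⁻¹' Iic 0) :=
    isCompact_Icc.of_isClosed_subset hclosed inter_subset_left
  obtain ⟨s₀, hs₀, hs₀'⟩ := h
  obtain ⟨s, hs, hmax⟩ := hcomp.exists_isGreatest ⟨s₀, hs₀, hs₀'⟩
  refine ⟨s, hs.1, hs.2, fun u hu => ?_⟩
  by_contra! hcon
  exact absurd (hmax ⟨⟨hs.1.1.trans hu.1.le, hu.2⟩, hcon⟩) (not_le.2 hu.1)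

/-! ### Estimates along the solution. -/

section Solution

variable {f g x : ℝ → ℝ} {ξ β : ℝ}

/-- At a first zero the derivative would be `g s > 0`, but slopes from the left are nonpositive. -/
theorem IsSolution.pos (hx : IsSolution f g ξ x) (hf0 : f 0 = 0)
    (hg_pos : ∀ t : ℝ, 0 < t → 0 < g t) (hξ : 0 < ξ) {t : ℝ} (ht : 0 ≤ t) : 0 < x t := by
  by_contra! hneg
  have hcont : ContinuousOn x (Icc 0 t) := hx.continuousOn.mono Icc_subset_Ici_self
  have hcomp : IsCompact (Icc 0 t ∩ x ⁻¹' Iic 0) := isCompact_Icc.of_isClosed_subset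
    (hcont.preimage_isClosed_of_isClosed isClosed_Icc isClosed_Iic) inter_subset_left
  obtain ⟨s, ⟨hs, hxs⟩, hmin⟩ := hcomp.exists_isLeast ⟨t, right_mem_Icc.2 ht, hneg⟩
  have hxs : x s ≤ 0 := hxs
  have hbefore : ∀ u, 0 ≤ u → u < s → 0 < x u := by
    intro u hu hus
    by_contra! hcon
    exact absurd (hmin ⟨⟨hu, hus.le.trans hs.2⟩, hcon⟩) (not_le.2 hus)
  have hs0 : 0 < s := by
    refine lt_of_le_of_ne hs.1 fun h => ?_
    rw [← h, hx.initial] at hxs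
    linarith
  have hder := hx.hasDerivAt s hs0
  have hnear : ∀ᶠ u in 𝓝[<] s, 0 < x u := by
    filter_upwards [Ioo_mem_nhdsLT hs0] with u hu using hbefore u hu.1.le hu.2
  have hxs0 : x s = 0 := le_antisymm hxs <|
    ge_of_tendsto (hder.continuousAt.tendsto.mono_left nhdsWithin_le_nhds)
      (hnear.mono fun u hu => hu.le)
  rw [hxs0, hf0, neg_zero, zero_add] at hder
  have hslope : Tendsto (slope x s) (𝓝[<] s) (𝓝 (g s)) :=
    (hasDerivAt_iff_tendsto_slope.1 hder).mono_left (nhdsWithin_mono s fun u hu => (ne_of_lt hu))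
  refine absurd (le_of_tendsto hslope ?_) (not_le.2 (hg_pos s hs0))
  filter_upwards [hnear, self_mem_nhdsWithin] with u hu hus
  rw [slope_def_field, hxs0, sub_zero]
  exact div_nonpos_of_nonneg_of_nonpos hu.le (sub_nonpos.2 (le_of_lt hus))

theorem eventually_mul_lt_of_le_bigF (hc : Continuous f) (hβ : 1 < β) (hf : RegVaryZero f β)
    (hF : Tendsto (bigF f) (𝓝[>] 0) atTop)
    (hgF : Tendsto (fun t => g t / f (bigFInv f t)) atTop atTop) {c : ℝ} (hcpos : 0 < c) :
    ∀ᶠ t in atTop, ∀ y, 0 < y → c * t ≤ bigF f y → f y < g t := by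
  obtain ⟨C, hC, hev⟩ := exists_le_mul_bigFInv hc hβ hf hF hcpos
  obtain ⟨r, hr, hmono⟩ := exists_forall_le_mul_of_le hc (one_pos.trans hβ) hf one_pos
  have hz := tendsto_bigFInv hc hf.pos hF
  have hCβ : 0 < C ^ β := by positivity
  -- The 2 is the almost-monotonicity loss; `C ^ β + 1` bounds `f(Cz) / f(z)`.
  filter_upwards [hev, hgF.eventually_gt_atTop (2 * (C ^ β + 1)),
    hz.eventually (Ioo_mem_nhdsGT (show 0 < r / C by positivity)),
    (hz.eventually ((hf.tendsto C hC).eventually (gt_mem_nhds (lt_add_one _))))]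
    with t h1 h2 h3 h4 y hy hty
  have hfz := hf.pos _ h3.1
  have h5 := hmono y _ hy (h1 y hty) ((lt_div_iff₀' hC).1 h3.2)
  rw [lt_div_iff₀ hfz] at h2
  rw [div_lt_iff₀ hfz] at h4
  linarith

theorem IsSolution.hasDerivAt_bigF_comp (hc : Continuous f) (hfpos : ∀ y, 0 < y → 0 < f y)
    (hx : IsSolution f g ξ x) {t : ℝ} (ht : 0 < t) (hxt : 0 < x t) :
    HasDerivAt (fun s => bigF f (x s)) (1 - g t / f (x t)) t := by
  have := hfpos _ hxt
  refine ((hasDerivAt_bigF hc hfpos hxt).comp t (hx.hasDerivAt t ht)).congr_deriv ?_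
  field_simp
  ring

theorem IsSolution.eventually_le_mul (hc : Continuous f) (hβ : 1 < β) (hf : RegVaryZero f β)
    (hF : Tendsto (bigF f) (𝓝[>] 0) atTop)
    (hgF : Tendsto (fun t => g t / f (bigFInv f t)) atTop atTop)
    (hg : ContinuousOn g (Ici 0)) {α : ℝ} (hgα : RegVaryInfty g α)
    (hx : IsSolution f g ξ x) (hxpos : ∀ t, 0 ≤ t → 0 < x t) (hx0 : Tendsto x atTop (𝓝 0))
    {ε : ℝ} (hε : 0 < ε) : ∀ᶠ t in atTop, f (x t) ≤ (1 + ε) ^ 3 * g t := by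
  obtain ⟨μ, hμ0, hμ1, hgev⟩ := exists_forall_le_mul_of_tendsto_div
    (hg.mono Ioi_subset_Ici_self) hgα.pos hgα.tendsto hε
  obtain ⟨r, hr, hmono⟩ := exists_forall_le_mul_of_le hc (one_pos.trans hβ) hf hε
  have h1ε : 0 < 1 + ε := by linarith
  set c := ε / (1 + ε) with hcdef
  have hc0 : 0 < c := by positivity
  have hc1 : c = 1 - 1 / (1 + ε) := by rw [hcdef]; field_simp; ring
  have hkey := eventually_mul_lt_of_le_bigF hc hβ hf hF hgF
    (show 0 < c * (1 - μ) from mul_pos hc0 (by linarith))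
  -- Below `r`, `f` is almost increasing; below 1, `F` is nonnegative.
  obtain ⟨T, hT⟩ := eventually_atTop.1
    (hx0.eventually (gt_mem_nhds (show 0 < min r 1 by positivity)))
  filter_upwards [hgev, hkey, eventually_ge_atTop (T / μ), eventually_gt_atTop 0]
    with t hgt hkt hTt ht
  have hμt : 0 < μ * t := by positivity
  have hTt : T ≤ μ * t := by rwa [div_le_iff₀' hμ0] at hTt
  have hat : μ * t ≤ t := by nlinarith
  have hs0 : ∀ s ∈ Icc (μ * t) t, 0 < s := fun s hs => hμt.trans_le hs.1
  have hxs : ∀ s ∈ Icc (μ * t) t, 0 < x s := fun s hs => hxpos s (hs0 s hs).le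
  have hxr : ∀ s ∈ Icc (μ * t) t, x s < min r 1 := fun s hs => hT s (hTt.trans hs.1)
  have hfx : ∀ s ∈ Icc (μ * t) t, 0 < f (x s) := fun s hs => hf.pos _ (hxs s hs)
  have hcont : ContinuousOn (fun s => f (x s) - (1 + ε) * g s) (Icc (μ * t) t) := by
    have hsub : Icc (μ * t) t ⊆ Ici 0 := fun s hs => (hs0 s hs).le
    exact (hc.comp_continuousOn (hx.continuousOn.mono hsub)).sub
      (continuousOn_const.mul (hg.mono hsub))
  have hex : ∃ s ∈ Icc (μ * t) t, f (x s) - (1 + ε) * g s ≤ 0 := by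
    by_contra! hcon
    have hder := mul_sub_le_sub_of_hasDerivAt (C := c) hat
      (fun s hs => hx.hasDerivAt_bigF_comp hc hf.pos (hs0 s hs) (hxs s hs)) (fun s hs => by
        have hs := Ioo_subset_Icc_self hs
        have h1 := hcon s hs
        have h2 : g s / f (x s) ≤ 1 / (1 + ε) := by
          rw [div_le_div_iff₀ (hfx s hs) h1ε]; linarith
        linarith)
    have hl := left_mem_Icc.2 hat
    have hr := right_mem_Icc.2 hat
    have h3 := bigF_nonneg hc hf.pos (hxs _ hl) ((hxr _ hl).le.trans (min_le_right _ _))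
    have h4 := hkt (x t) (hxs t hr) (by linarith)
    have h5 := hcon t hr
    nlinarith [hgα.pos t ht]
  obtain ⟨s, hs, hs1, hs2⟩ := exists_last_nonpos hcont hex
  have hst : Icc s t ⊆ Icc (μ * t) t := Icc_subset_Icc_left hs.1
  have hdec := sub_le_mul_sub_of_hasDerivAt (C := 0) hs.2
    (fun u hu => hx.hasDerivAt u (hs0 u (hst hu))) (fun u hu => by
      have h1 := hs2 u (Ioo_subset_Ioc_self hu)
      have h2 := hgα.pos u (hs0 u (hst (Ioo_subset_Icc_self hu)))
      nlinarith)
  have h1 := hmono (x t) (x s) (hxs t (right_mem_Icc.2 hat)) (by linarith)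
    ((hxr s hs).trans_le (min_le_left _ _))
  have h2 := (hgt s hs).1
  calc f (x t) ≤ (1 + ε) * f (x s) := h1
    _ ≤ (1 + ε) * ((1 + ε) * g s) := by gcongr; linarith
    _ ≤ (1 + ε) * ((1 + ε) * ((1 + ε) * g t)) := by gcongr
    _ = (1 + ε) ^ 3 * g t := by ring

theorem IsSolution.eventually_ge_mul (hc : Continuous f) (hβ : 1 < β) (hf : RegVaryZero f β)
    (hF : Tendsto (bigF f) (𝓝[>] 0) atTop)
    (hgF : Tendsto (fun t => g t / f (bigFInv f t)) atTop atTop)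
    (hg : ContinuousOn g (Ici 0)) {α : ℝ} (hgα : RegVaryInfty g α)
    (hx : IsSolution f g ξ x) (hxpos : ∀ t, 0 ≤ t → 0 < x t) (hx0 : Tendsto x atTop (𝓝 0))
    {ε : ℝ} (hε : 0 < ε) : ∀ᶠ t in atTop, g t ≤ (1 + ε) ^ 3 * f (x t) := by
  obtain ⟨μ, hμ0, hμ1, hgev⟩ := exists_forall_le_mul_of_tendsto_div
    (hg.mono Ioi_subset_Ici_self) hgα.pos hgα.tendsto hε
  obtain ⟨r, hr, hmono⟩ := exists_forall_le_mul_of_le hc (one_pos.trans hβ) hf hε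
  have h1ε : 0 < 1 + ε := by linarith
  have h1μ : 0 < (1 - μ) / 2 := by linarith
  have hz := tendsto_bigFInv hc hf.pos hF
  obtain ⟨c₀, hc₀, hlow⟩ := exists_mul_le_bigF_mul hc (one_pos.trans hβ) hf
  obtain ⟨C, hC, hkey⟩ := exists_le_mul_bigFInv hc hβ hf hF
    (show 0 < ε * ((1 - μ) / 2) by positivity)
  -- Under `g > (1+ε) f(x)`, `x' ≥ (ε/(1+ε)) g(s)`; replacing `g(s)` by `g(t)` costs another `1 +
  -- ε`, and half the window has length `((1-μ)/2) t`.
  set d := ε / (1 + ε) / (1 + ε) * ((1 - μ) / 2) with hd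
  have hd0 : 0 < d := by positivity
  obtain ⟨T, hT⟩ := eventually_atTop.1
    (hx0.eventually (gt_mem_nhds (show 0 < min r 1 by positivity)))
  filter_upwards [hgev, hkey, eventually_ge_atTop (T / μ), eventually_gt_atTop 0,
    hz.eventually hlow, hgF.eventually_gt_atTop (C / (d * c₀))]
    with t hgt hkt hTt ht hlt hgFt
  have hμt : 0 < μ * t := by positivity
  have hTt : T ≤ μ * t := by rwa [div_le_iff₀' hμ0] at hTt
  have hat : μ * t ≤ t := by nlinarith
  have hs0 : ∀ s ∈ Icc (μ * t) t, 0 < s := fun s hs => hμt.trans_le hs.1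
  have hxs : ∀ s ∈ Icc (μ * t) t, 0 < x s := fun s hs => hxpos s (hs0 s hs).le
  have hxr : ∀ s ∈ Icc (μ * t) t, x s < min r 1 := fun s hs => hT s (hTt.trans hs.1)
  have hfx : ∀ s ∈ Icc (μ * t) t, 0 < f (x s) := fun s hs => hf.pos _ (hxs s hs)
  have hcont : ContinuousOn (fun s => g s - (1 + ε) * f (x s)) (Icc (μ * t) t) := by
    have hsub : Icc (μ * t) t ⊆ Ici 0 := fun s hs => (hs0 s hs).le
    exact (hg.mono hsub).sub
      (continuousOn_const.mul (hc.comp_continuousOn (hx.continuousOn.mono hsub)))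
  have hex : ∃ s ∈ Icc (μ * t) t, g s - (1 + ε) * f (x s) ≤ 0 := by
    by_contra! hcon
    set b := (μ * t + t) / 2 with hb
    have hab : μ * t ≤ b := by linarith
    have hbt : b ≤ t := by linarith
    have hbm : b ∈ Icc (μ * t) t := ⟨hab, hbt⟩
    have hsub1 : Icc (μ * t) b ⊆ Icc (μ * t) t := Icc_subset_Icc_right hbt
    have hsub2 : Icc b t ⊆ Icc (μ * t) t := Icc_subset_Icc_left hab
    have hder := sub_le_mul_sub_of_hasDerivAt (C := -ε) hbt
      (fun s hs => hx.hasDerivAt_bigF_comp hc hf.pos (hs0 s (hsub2 hs)) (hxs s (hsub2 hs)))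
      (fun s hs => by
        have hs := hsub2 (Ioo_subset_Icc_self hs)
        have h1 := hcon s hs
        have h2 : 1 + ε ≤ g s / f (x s) := by
          rw [le_div_iff₀ (hfx s hs)]; linarith
        linarith)
    have hrt := right_mem_Icc.2 hat
    have h3 := bigF_nonneg hc hf.pos (hxs t hrt) ((hxr t hrt).le.trans (min_le_right _ _))
    have h4 := hkt (x b) (by
      have : ε * ((1 - μ) / 2) * t = ε * (t - b) := by rw [hb]; ring
      linarith)
    have hinc := mul_sub_le_sub_of_hasDerivAt (C := ε / (1 + ε) / (1 + ε) * g t) hab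
      (fun s hs => hx.hasDerivAt s (hs0 s (hsub1 hs))) (fun s hs => by
        have hs := hsub1 (Ioo_subset_Icc_self hs)
        have h1 := hcon s hs
        have h2 := (hgt s hs).2
        have h5 : ε / (1 + ε) / (1 + ε) * g t ≤ ε / (1 + ε) / (1 + ε) * ((1 + ε) * g s) := by
          gcongr
        have h6 : ε / (1 + ε) / (1 + ε) * ((1 + ε) * g s) = g s - g s / (1 + ε) := by
          field_simp; ring
        have h7 : f (x s) ≤ g s / (1 + ε) := by rw [le_div_iff₀ h1ε]; linarith
        linarith)
    have h5 := hxs (μ * t) (left_mem_Icc.2 hat)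
    obtain ⟨hz0, hFz⟩ := bigFInv_spec hc hf.pos hF ht.le
    -- The midpoint bounds give `d t g(t) ≤ C z`, while `c₀ z ≤ t f(z)`; together they cap `g(t) /
    -- f(z)` by `C / (d c₀)`.
    set z := bigFInv f t
    have hfz := hf.pos z hz0
    rw [hFz] at hlt
    rw [lt_div_iff₀ hfz, div_mul_eq_mul_div, div_lt_iff₀ (by positivity)] at hgFt
    have h6 : d * g t * t ≤ C * z := by
      have : d * g t * t = ε / (1 + ε) / (1 + ε) * g t * (b - μ * t) := by rw [hd, hb]; ring
      linarith
    have h7 : C * (c₀ * z) ≤ C * (t * f z) := by gcongr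
    have h8 : C * f z * t < g t * (d * c₀) * t := by gcongr
    have h9 : d * g t * t * c₀ ≤ C * z * c₀ := by gcongr
    linarith
  obtain ⟨s, hs, hs1, hs2⟩ := exists_last_nonpos hcont hex
  have hst : Icc s t ⊆ Icc (μ * t) t := Icc_subset_Icc_left hs.1
  have hinc := mul_sub_le_sub_of_hasDerivAt (C := 0) hs.2
    (fun u hu => hx.hasDerivAt u (hs0 u (hst hu))) (fun u hu => by
      have h1 := hs2 u (Ioo_subset_Ioc_self hu)
      have h2 := hfx u (hst (Ioo_subset_Icc_self hu))
      nlinarith)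
  have h1 := hmono (x s) (x t) (hxs s hs) (by linarith)
    ((hxr t (right_mem_Icc.2 hat)).trans_le (min_le_left _ _))
  have h2 := (hgt s hs).2
  calc g t ≤ (1 + ε) * g s := h2
    _ ≤ (1 + ε) * ((1 + ε) * f (x s)) := by gcongr; linarith
    _ ≤ (1 + ε) * ((1 + ε) * ((1 + ε) * f (x t))) := by gcongr
    _ = (1 + ε) ^ 3 * f (x t) := by ring

theorem IsSolution.tendsto_div (hc : Continuous f) (hβ : 1 < β) (hf : RegVaryZero f β)
    (hF : Tendsto (bigF f) (𝓝[>] 0) atTop)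
    (hgF : Tendsto (fun t => g t / f (bigFInv f t)) atTop atTop)
    (hg : ContinuousOn g (Ici 0)) {α : ℝ} (hgα : RegVaryInfty g α)
    (hx : IsSolution f g ξ x) (hxpos : ∀ t, 0 ≤ t → 0 < x t) (hx0 : Tendsto x atTop (𝓝 0)) :
    Tendsto (fun t => f (x t) / g t) atTop (𝓝 1) := by
  have hlim : Tendsto (fun ε : ℝ => (1 + ε) ^ 3) (𝓝[>] 0) (𝓝 1) := by
    have : ContinuousAt (fun ε : ℝ => (1 + ε) ^ 3) 0 := by fun_prop
    simpa using this.tendsto.mono_left nhdsWithin_le_nhds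
  refine tendsto_order.2 ⟨fun a ha => ?_, fun a ha => ?_⟩
  · have hlim' : Tendsto (fun ε : ℝ => a * (1 + ε) ^ 3) (𝓝[>] 0) (𝓝 a) := by
      simpa using hlim.const_mul a
    obtain ⟨ε, hεa, hε⟩ := ((hlim'.eventually (gt_mem_nhds ha)).and self_mem_nhdsWithin).exists
    have hε : 0 < ε := hε
    filter_upwards [hx.eventually_ge_mul hc hβ hf hF hgF hg hgα hxpos hx0 hε,
      eventually_gt_atTop 0] with t h1 ht
    have hgt := hgα.pos t ht
    have hft := hf.pos _ (hxpos t ht.le)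
    rw [lt_div_iff₀ hgt]
    rcases le_or_gt a 0 with ha0 | ha0
    · nlinarith
    · calc a * g t ≤ a * ((1 + ε) ^ 3 * f (x t)) := by gcongr
        _ = a * (1 + ε) ^ 3 * f (x t) := by ring
        _ < 1 * f (x t) := by gcongr
        _ = f (x t) := one_mul _
  · obtain ⟨ε, hεa, hε⟩ := ((hlim.eventually (gt_mem_nhds ha)).and self_mem_nhdsWithin).exists
    have hε : 0 < ε := hε
    filter_upwards [hx.eventually_le_mul hc hβ hf hF hgF hg hgα hxpos hx0 hε,
      eventually_gt_atTop 0] with t h1 ht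
    have hgt := hgα.pos t ht
    rw [div_lt_iff₀ hgt]
    exact h1.trans_lt (by gcongr)

end Solution

end PerturbedODE

theorem mainTheorem4 (f g x : ℝ → ℝ) (ξ β θ : ℝ)
    (hf_stable : (∀ y : ℝ, y ≠ 0 → 0 < y * f y) ∧ f 0 = 0)
    (hf_lip : LocallyLipschitz f)
    (hF : Tendsto (PerturbedODE.bigF f) (𝓝[>] 0) atTop)
    (hf_cont : Continuous f) (hg_cont : ContinuousOn g (Ici 0))
    (hg_pos : ∀ t : ℝ, 0 < t → 0 < g t) (hξ : 0 < ξ)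
    (hgF : Tendsto (fun t => g t / f (PerturbedODE.bigFInv f t)) atTop atTop)
    (hβ : 1 < β) (hf_rv : PerturbedODE.RegVaryZero f β)
    (hθ : 0 ≤ θ) (hg_rv : PerturbedODE.RegVaryInfty g (-θ))
    (hx : PerturbedODE.IsSolution f g ξ x)
    (hx_lim : Tendsto x atTop (𝓝 0)) :
    (0 < θ → Tendsto (fun t => f (x t) / g t) atTop (𝓝 1)) ∧
    (θ = 0 → PerturbedODE.AsymptoticToDecreasing g →
      Tendsto (fun t => f (x t) / g t) atTop (𝓝 1)) := by
  have h := hx.tendsto_div hf_cont hβ hf_rv hF hgF hg_cont hg_rv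
    (fun t ht => hx.pos hf_stable.2 hg_pos hξ ht) hx_lim
  exact ⟨fun _ => h, fun _ _ => h⟩
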